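/- Let $n,s\in\mathbb{N}$, let $d\ge 2$ be an even integer, let $w_1,\dots,w_s\in\mathbb{R}[x]=\mathbb{R}[x_1,\dots,x_n]$, and let $K=\{x\in\mathbb{R}^n : w_j(x)\ge 0,\ j=1,\dots,s\}$. Put $w_0=1$ and $v_j=\lceil \deg(w_j)/2\rceil$ for $j=0,\dots,s$. For an integer $m$ let $\Sigma_m$ be the set of sums of squares of polynomials in $\mathbb{R}[x]$ that have degree at most $2m$ (so $\Sigma_m=\{0\}$ if $m<0$), and for $k\in\mathbb{N}$ let $$\mathcal{C}_k=\Big\{\sum_{j=0}^s\sigma_j w_j : \sigma_j\in\Sigma_{k-v_j},\ j=0,\dots,s\Big\}.$$ Let $\mathbf{P}[x]_d$ be the set of nonnegative homogeneous polynomials $g\in\mathbb{R}[x]$ of degree $d$ for which $\{x\in\mathbb{R}^n : g(x)\le 1\}$ has finite Lebesgue volume. For $k\in\mathbb{N}$ let $\mathcal{P}_k$ be the problem of minimizing $\int_{\mathbb{R}^n}\exp(-g(x))\,dx\in[0,\infty]$ over all polynomials $g=\sum_\alpha g_\alpha x^\alpha\in\mathbb{R}[x]$ of degree at most $d$ with $g_\alpha=0$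 for all $|\alpha|<d$ and with $1-g\in\mathcal{C}_k$. Assume that $K$ is compact with nonempty interior and that there are $M>0$ and $k\in\mathbb{N}$ such that the polynomial $M-\sum_{i=1}^n x_i^2$ belongs to $\mathcal{C}_k$ (Archimedean assumption). Then there is $k_0\in\mathbb{N}$ such that for every $k\ge k_0$ the problem $\mathcal{P}_k$ has a unique optimal solution $g_k^*$, and $g_k^*\in\mathbf{P}[x]_d$. -/

import Mathlib

open MeasureTheory
open scoped ENNReal

noncomputable section

namespace LownerJohn

/-- The basic semi-algebraic set `{x ∈ ℝⁿ : w_j(x) ≥ 0 for all j}`. -/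
def semialgebraicSet {n s : ℕ} (w : Fin s → MvPolynomial (Fin n) ℝ) : Set (Fin n → ℝ) :=
  {x | ∀ j, 0 ≤ MvPolynomial.eval x (w j)}

/-- The set `P[x]_d` of nonnegative homogeneous polynomials of degree `d` whose sublevel set
`{x : g(x) ≤ 1}` has finite Lebesgue volume. -/
def finiteVolumeForms (n d : ℕ) : Set (MvPolynomial (Fin n) ℝ) :=
  {g | g.IsHomogeneous d ∧ (∀ x : Fin n → ℝ, 0 ≤ MvPolynomial.eval x g) ∧
    volume {x : Fin n → ℝ | MvPolynomial.eval x g ≤ 1} < ∞}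

/-- `v = ⌈deg(w) / 2⌉`. -/
def halfDegree {n : ℕ} (w : MvPolynomial (Fin n) ℝ) : ℕ := (w.totalDegree + 1) / 2

/-- The sums of squares of degree at most `2 (k - v)`. The difference is taken in the integers:
if `k < v`, the only such polynomial is `0`. -/
def truncatedSOS (n k v : ℕ) : Set (MvPolynomial (Fin n) ℝ) :=
  {σ | IsSumSq σ ∧ (σ = 0 ∨ σ.totalDegree + 2 * v ≤ 2 * k)}

/-- The truncated quadratic module of all `σ_0 + ∑_j σ_j w_j`, where `σ_0` is a sum of squares
of degree at most `2 k` and `σ_j` one of degree at most `2 (k - ⌈deg(w_j) / 2⌉)`. -/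
def truncatedModule {n s : ℕ} (w : Fin s → MvPolynomial (Fin n) ℝ) (k : ℕ) :
    Set (MvPolynomial (Fin n) ℝ) :=
  {p | ∃ (σ₀ : MvPolynomial (Fin n) ℝ) (σ : Fin s → MvPolynomial (Fin n) ℝ),
    σ₀ ∈ truncatedSOS n k 0 ∧ (∀ j, σ j ∈ truncatedSOS n k (halfDegree (w j))) ∧
    p = σ₀ + ∑ j, σ j * w j}

/-- The Archimedean assumption: `M - ‖x‖²` belongs to some truncated module, with `M > 0`. -/
def Archimedean {n s : ℕ} (w : Fin s → MvPolynomial (Fin n) ℝ) : Prop :=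
  ∃ M : ℝ, 0 < M ∧ ∃ k : ℕ,
    MvPolynomial.C M - ∑ i : Fin n, (MvPolynomial.X i : MvPolynomial (Fin n) ℝ) ^ 2
      ∈ truncatedModule w k

/-- The objective `∫ exp(-g) dx` over `ℝⁿ`, with value in `[0, ∞]`. -/
def objective {n : ℕ} (g : MvPolynomial (Fin n) ℝ) : ℝ≥0∞ :=
  ∫⁻ x : Fin n → ℝ, ENNReal.ofReal (Real.exp (-MvPolynomial.eval x g))

/-- The feasible polynomials `g` of the `k`-th problem: `g` has degree at most `d`, all its
coefficients of degree less than `d` vanish, and `1 - g` lies in the truncated module. -/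
def feasibleSet {n s : ℕ} (d : ℕ) (w : Fin s → MvPolynomial (Fin n) ℝ) (k : ℕ) :
    Set (MvPolynomial (Fin n) ℝ) :=
  {g | g.totalDegree ≤ d ∧ (∀ α : Fin n →₀ ℕ, α.degree < d → g.coeff α = 0) ∧
    1 - g ∈ truncatedModule w k}

/-- `g` is an optimal solution of the `k`-th problem. -/
def IsOptimalSolution {n s : ℕ} (d : ℕ) (w : Fin s → MvPolynomial (Fin n) ℝ) (k : ℕ)
    (g : MvPolynomial (Fin n) ℝ) : Prop :=
  g ∈ feasibleSet d w k ∧ ∀ h ∈ feasibleSet d w k, objective g ≤ objective h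

end LownerJohn

end

noncomputable section

namespace LownerJohn

open MvPolynomial Filter Topology
open scoped Pointwise

/-! Existence comes from compactness in a space of Gram factors. A feasible `g` is `1 - ∑ σ_j w_j`,
each `σ_j` being encoded by a square matrix (`mem_truncatedSOS_iff`). On a ball inside `K` where
every nonzero weight is at least `δ > 0`, `g ≥ 0` forces `σ_j ≤ 1 / δ`, which bounds the matrices
(`isBounded_feasibleParams`). The objective is lower semicontinuous by Fatou, so it attains its
minimum over nonnegative feasible forms; a form with a negative value has infinite objective
(`objective_eq_top_of_eval_neg`) and cannot compete. With `d = 2m`, the Archimedean assumption makes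
`‖x‖^(2m) / M^m` feasible for large `k`, with finite objective. Uniqueness is strict convexity of
`exp` (`eq_of_objective_le_midpoint`). -/

/-! ### Sums of squares of bounded degree and their Gram factors. -/

theorem exists_fin_sum_mul_self_of_isSumSq {R : Type*} [CommRing R] {a : R} (ha : IsSumSq a) :
    ∃ (r : ℕ) (q : Fin r → R), a = ∑ i, q i * q i := by
  induction ha using IsSumSq.rec' with
  | zero => exact ⟨0, fun _ => 0, by simp⟩
  | sq_add hx _ ih =>
    obtain ⟨r, q, rfl⟩ := ih
    obtain ⟨b, rfl⟩ := hx
    exact ⟨r + 1, Fin.cons b q, by simp [Fin.sum_univ_succ]⟩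

theorem homogeneousComponent_mul_self {σ : Type*} {q : MvPolynomial σ ℝ} {D : ℕ}
    (hq : q.totalDegree ≤ D) :
    homogeneousComponent (D + D) (q * q) =
      homogeneousComponent D q * homogeneousComponent D q := by
  have hsum : q = ∑ i ∈ Finset.range (D + 1), homogeneousComponent i q := by
    conv_lhs => rw [← sum_homogeneousComponent q]
    refine Finset.sum_subset (Finset.range_mono (by omega)) fun i _ hi => ?_
    exact homogeneousComponent_eq_zero _ _ (by simpa using hi)
  have hmem (i j : ℕ) : homogeneousComponent (D + D)
      (homogeneousComponent i q * homogeneousComponent j q) =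
      if i + j = D + D then homogeneousComponent i q * homogeneousComponent j q else 0 := by
    rw [homogeneousComponent_of_mem
      ((homogeneousComponent_isHomogeneous i q).mul (homogeneousComponent_isHomogeneous j q))]
    simp [eq_comm]
  conv_lhs => rw [hsum, Finset.sum_mul_sum]
  simp only [map_sum, hmem]
  rw [Finset.sum_eq_single D, Finset.sum_eq_single D]
  · simp
  · intro j hj hne
    exact if_neg (by omega)
  · simp
  · intro i hi hne
    refine Finset.sum_eq_zero fun j hj => if_neg ?_
    simp only [Finset.mem_range] at hi hj
    omega
  · simp

theorem eq_zero_of_sum_mul_self_eq_zero {σ ι : Type*} [Fintype ι] {q : ι → MvPolynomial σ ℝ}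
    (h : ∑ i, q i * q i = 0) (i : ι) : q i = 0 := by
  refine MvPolynomial.funext fun x => ?_
  have hx := congrArg (eval x) h
  simp only [map_sum, map_mul, map_zero] at hx ⊢
  have := (Finset.sum_eq_zero_iff_of_nonneg fun i _ => mul_self_nonneg (eval x (q i))).1 hx i
    (Finset.mem_univ i)
  simpa using this

/-- Top-degree parts of real squares cannot cancel, so a common degree bound above `m` can be
lowered one step at a time. -/
theorem totalDegree_le_of_sum_mul_self {σ ι : Type*} [Fintype ι] {q : ι → MvPolynomial σ ℝ}
    {m : ℕ} (h : (∑ i, q i * q i).totalDegree ≤ 2 * m) (i : ι) : (q i).totalDegree ≤ m := by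
  have key (e : ℕ) : (∀ i, (q i).totalDegree ≤ m + e) → ∀ i, (q i).totalDegree ≤ m := by
    induction e with
    | zero => exact id
    | succ e ih =>
      intro hq
      refine ih fun i => ?_
      have hz : ∑ i, homogeneousComponent (m + (e + 1)) (q i) *
          homogeneousComponent (m + (e + 1)) (q i) = 0 := by
        simp only [← homogeneousComponent_mul_self (hq _), ← map_sum]
        exact homogeneousComponent_eq_zero _ _ (by omega)
      have hi := eq_zero_of_sum_mul_self_eq_zero hz i
      refine Finset.sup_le fun α hα => ?_
      have h1 : α.degree ≤ m + (e + 1) := (le_totalDegree hα).trans (hq i)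
      have h2 : α.degree ≠ m + (e + 1) := fun h => by
        have h3 := congrArg (coeff α) hi
        rw [coeff_homogeneousComponent, if_pos h] at h3
        exact mem_support_iff.1 hα h3
      change α.degree ≤ _
      omega
  -- The sum of all the degrees is a crude bound from which to descend.
  exact key (∑ i, (q i).totalDegree)
    (fun i => (Finset.single_le_sum (f := fun i => (q i).totalDegree) (fun _ _ => Nat.zero_le _)
      (Finset.mem_univ i)).trans (by omega)) i

/-- The exponents of the monomials that may occur in a square of weight `v` at level `k`. -/
abbrev Exponents (n k v : ℕ) : Type := {α : Fin n →₀ ℕ // α.degree + v ≤ k}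

instance (n k v : ℕ) : Finite (Exponents n k v) := by
  refine Set.Finite.subset (s := {α : Fin n →₀ ℕ | α.degree ≤ k}) ?_ (fun α h => ?_)
  · exact Finsupp.finite_of_degree_le k
  · exact le_trans (Nat.le_add_right _ _) h

instance (n k v : ℕ) : Fintype (Exponents n k v) := Fintype.ofFinite _

/-- The polynomial with coefficient vector `c`. -/
def polyOf {n k v : ℕ} (c : Exponents n k v → ℝ) : MvPolynomial (Fin n) ℝ :=
  ∑ a, monomial a.1 (c a)

/-- The sum of the squares of the polynomials given by the rows of `B`. -/
def sosOf {n k v : ℕ} (B : Exponents n k v → Exponents n k v → ℝ) :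
    MvPolynomial (Fin n) ℝ :=
  ∑ i, polyOf (B i) * polyOf (B i)

theorem coeff_polyOf {n k v : ℕ} (c : Exponents n k v → ℝ) (a : Exponents n k v) :
    coeff a.1 (polyOf c) = c a := by
  simp [polyOf, coeff_sum, coeff_monomial, ← Subtype.ext_iff]

theorem totalDegree_polyOf {n k v : ℕ} (hv : v ≤ k) (c : Exponents n k v → ℝ) :
    (polyOf c).totalDegree + v ≤ k := by
  have : (polyOf c).totalDegree ≤ k - v := by
    refine (totalDegree_finsetSum _ _).trans (Finset.sup_le fun a _ => ?_)
    refine (totalDegree_monomial_le _ _).trans ?_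
    have := a.2
    change a.1.degree ≤ _
    omega
  omega

theorem exists_polyOf_eq {n k v : ℕ} {p : MvPolynomial (Fin n) ℝ}
    (hp : p.totalDegree + v ≤ k) : ∃ c : Exponents n k v → ℝ, polyOf c = p := by
  refine ⟨fun a => coeff a.1 p, ?_⟩
  ext α
  by_cases hα : α.degree + v ≤ k
  · exact coeff_polyOf (k := k) (v := v) _ ⟨α, hα⟩
  · rw [polyOf, coeff_sum, Finset.sum_eq_zero, eq_comm]
    · refine coeff_eq_zero_of_totalDegree_lt ?_
      change _ < α.degree
      omega
    · rintro a -
      rw [coeff_monomial, if_neg]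
      rintro rfl
      exact hα a.2

theorem sum_polyOf_mul_self {n k v : ℕ} {ι : Type*} [Fintype ι]
    (B : Matrix ι (Exponents n k v) ℝ) :
    ∑ i, polyOf (B i) * polyOf (B i) =
      ∑ a, ∑ b, monomial (a.1 + b.1) ((B.conjTranspose * B) a b) := by
  simp only [polyOf, Finset.sum_mul_sum, monomial_mul, Matrix.mul_apply,
    Matrix.conjTranspose_apply, map_sum, star_trivial]
  rw [Finset.sum_comm]
  exact Finset.sum_congr rfl fun a _ => Finset.sum_comm

open scoped MatrixOrder Matrix.Norms.L2Operator in
theorem mem_truncatedSOS_iff {n k v : ℕ} {σ : MvPolynomial (Fin n) ℝ} :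
    σ ∈ truncatedSOS n k v ↔
      ∃ B : Exponents n k v → Exponents n k v → ℝ, σ = sosOf B := by
  constructor
  · rintro ⟨hσ, rfl | hdeg⟩
    · exact ⟨0, by simp [sosOf, polyOf]⟩
    have hv : v ≤ k := by omega
    obtain ⟨r, q, rfl⟩ := exists_fin_sum_mul_self_of_isSumSq hσ
    have hq (i) : (q i).totalDegree + v ≤ k := by
      have := totalDegree_le_of_sum_mul_self (q := q) (m := k - v) (by omega) i
      omega
    choose c hc using fun i => exists_polyOf_eq (hq i)
    -- The number of squares is arbitrary, but the Gram matrix has fixed size and is positive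
    -- semidefinite, hence has a square factor `B`.
    obtain ⟨B, hB⟩ := CStarAlgebra.nonneg_iff_eq_star_mul_self.1
      (Matrix.posSemidef_conjTranspose_mul_self (Matrix.of c)).nonneg
    refine ⟨B, ?_⟩
    have h1 := sum_polyOf_mul_self (Matrix.of c)
    rw [hB] at h1
    refine Eq.trans ?_ (h1.trans (sum_polyOf_mul_self B).symm)
    exact Finset.sum_congr rfl fun i _ => by rw [← hc i]; rfl
  · rintro ⟨B, rfl⟩
    refine ⟨IsSumSq.sum_mul_self _ _, ?_⟩
    by_cases hv : v ≤ k
    · right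
      have : (sosOf B).totalDegree ≤ 2 * (k - v) := by
        refine (totalDegree_finsetSum _ _).trans (Finset.sup_le fun i _ => ?_)
        refine (totalDegree_mul _ _).trans ?_
        have := totalDegree_polyOf hv (B i)
        omega
      omega
    -- For `k < v` there are no exponents, so the empty sum gives `0`, as the truncation convention
    -- requires.
    · left
      have : IsEmpty (Exponents n k v) := ⟨fun a => by have := a.2; omega⟩
      simp [sosOf]

theorem eval_sosOf {n k v : ℕ} (B : Exponents n k v → Exponents n k v → ℝ)
    (x : Fin n → ℝ) : eval x (sosOf B) = ∑ i, eval x (polyOf (B i)) ^ 2 := by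
  simp [sosOf, sq]

theorem eval_polyOf {n k v : ℕ} (c : Exponents n k v → ℝ) (x : Fin n → ℝ) :
    eval x (polyOf c) = ∑ a, c a * eval x (monomial a.1 1) := by
  simp [polyOf, eval_monomial]

/-! ### Compactness of the parameter set. -/

theorem eq_zero_of_eval_closedBall_eq_zero {n : ℕ} {p : MvPolynomial (Fin n) ℝ} {x₀ : Fin n → ℝ}
    {r : ℝ} (hr : 0 < r) (h : ∀ x ∈ Metric.closedBall x₀ r, eval x p = 0) : p = 0 := by
  refine funext_set (fun i => Metric.closedBall (x₀ i) r) (fun i => ?_) fun x hx => ?_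
  · rw [Real.closedBall_eq_Icc]
    exact Set.Icc_infinite (by linarith)
  · rw [map_zero]
    exact h x (by rwa [closedBall_pi _ hr.le])

/-- Restriction to the ball is an injective linear map on a finite-dimensional space, hence
antilipschitz. -/
theorem exists_norm_le_of_eval_closedBall_le {n : ℕ} (k v : ℕ) (x₀ : Fin n → ℝ) {r : ℝ}
    (hr : 0 < r) : ∃ C : ℝ, ∀ (c : Exponents n k v → ℝ) (M : ℝ), 0 ≤ M →
      (∀ x ∈ Metric.closedBall x₀ r, |eval x (polyOf c)| ≤ M) → ‖c‖ ≤ C * M := by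
  have : CompactSpace (Metric.closedBall x₀ r) :=
    isCompact_iff_compactSpace.1 (isCompact_closedBall x₀ r)
  let T : (Exponents n k v → ℝ) →ₗ[ℝ] C(Metric.closedBall x₀ r, ℝ) :=
    { toFun := fun c => ⟨fun x => eval x.1 (polyOf c),
        (continuous_eval (polyOf c)).comp continuous_subtype_val⟩
      map_add' := fun c c' => by
        ext x
        simp [polyOf, Finset.sum_add_distrib]
      map_smul' := fun t c => by
        ext x
        simp [eval_polyOf, Finset.mul_sum, mul_assoc] }
  have hT : T.ker = ⊥ := by
    refine LinearMap.ker_eq_bot'.2 fun c hc => ?_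
    have hp : polyOf c = 0 := eq_zero_of_eval_closedBall_eq_zero (x₀ := x₀) hr fun x hx =>
      DFunLike.congr_fun hc ⟨x, hx⟩
    ext a
    rw [← coeff_polyOf c a, hp]
    rfl
  obtain ⟨K, -, hK⟩ := T.exists_antilipschitzWith hT
  refine ⟨K, fun c M hM hc => ?_⟩
  have h1 := hK.le_mul_dist c 0
  rw [map_zero, dist_zero_right, dist_zero_right] at h1
  refine h1.trans (mul_le_mul_of_nonneg_left ?_ K.2)
  exact (ContinuousMap.norm_le _ hM).2 fun x => hc x.1 x.2

/-- The weights `w` together with the weight `1` at the index `none`. -/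
def weights {n s : ℕ} (w : Fin s → MvPolynomial (Fin n) ℝ) (j : Option (Fin s)) :
    MvPolynomial (Fin n) ℝ := j.elim 1 w

/-- The parameters of the elements of the truncated module: a square matrix for each weight. -/
abbrev Params {n s : ℕ} (w : Fin s → MvPolynomial (Fin n) ℝ) (k : ℕ) : Type :=
  (j : Option (Fin s)) → Exponents n k (halfDegree (weights w j)) →
    Exponents n k (halfDegree (weights w j)) → ℝ

/-- The polynomial `1 - ∑_j σ_j w_j` with the parameters `B`. -/
def oneSub {n s : ℕ} (w : Fin s → MvPolynomial (Fin n) ℝ) (k : ℕ) (B : Params w k) :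
    MvPolynomial (Fin n) ℝ := 1 - ∑ j, sosOf (B j) * weights w j

variable {n s : ℕ} {w : Fin s → MvPolynomial (Fin n) ℝ} {k d : ℕ}

theorem halfDegree_weights_none (w : Fin s → MvPolynomial (Fin n) ℝ) :
    halfDegree (weights w none) = 0 := by
  simp [weights, halfDegree]

theorem mem_truncatedModule_iff_weights {p : MvPolynomial (Fin n) ℝ} :
    p ∈ truncatedModule w k ↔ ∃ σ : Option (Fin s) → MvPolynomial (Fin n) ℝ,
      (∀ j, σ j ∈ truncatedSOS n k (halfDegree (weights w j))) ∧ p = ∑ j, σ j * weights w j := by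
  constructor
  · rintro ⟨σ₀, σ, h₀, h, rfl⟩
    refine ⟨fun j => j.elim σ₀ σ, ?_, ?_⟩
    · rintro (_ | j)
      · rw [halfDegree_weights_none]
        exact h₀
      · exact h j
    · simp [Fintype.sum_option, weights]
  · rintro ⟨σ, h, rfl⟩
    refine ⟨σ none, fun j => σ (some j), ?_, fun j => h (some j), ?_⟩
    · rw [← halfDegree_weights_none w]
      exact h none
    · simp [Fintype.sum_option, weights]

/-- A zero weight leaves its multiplier unconstrained; normalizing that multiplier to `0` keeps the
parameter set bounded. -/
theorem one_sub_mem_truncatedModule_iff {g : MvPolynomial (Fin n) ℝ} :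
    1 - g ∈ truncatedModule w k ↔
      ∃ B : Params w k, (∀ j, weights w j = 0 → B j = 0) ∧ oneSub w k B = g := by
  rw [mem_truncatedModule_iff_weights]
  constructor
  · rintro ⟨σ, hσ, h⟩
    choose B hB using fun j => mem_truncatedSOS_iff.1 (hσ j)
    classical
    refine ⟨fun j => if weights w j = 0 then 0 else B j, fun j hj => if_pos hj, ?_⟩
    rw [oneSub, sub_eq_iff_eq_add, ← sub_eq_iff_eq_add', h]
    refine Finset.sum_congr rfl fun j _ => ?_
    by_cases hj : weights w j = 0
    · simp [hj]
    · simp [hj, hB j]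
  · rintro ⟨B, -, rfl⟩
    refine ⟨fun j => sosOf (B j), fun j => mem_truncatedSOS_iff.2 ⟨_, rfl⟩, ?_⟩
    simp [oneSub]

theorem isHomogeneous_of_coeff_eq_zero {g : MvPolynomial (Fin n) ℝ}
    (h : ∀ α : Fin n →₀ ℕ, α.degree ≠ d → coeff α g = 0) : g.IsHomogeneous d := by
  intro α hα
  have hw : Finsupp.weight (1 : Fin n → ℕ) α = α.degree := by
    rw [Finsupp.degree_eq_weight_one]
    rfl
  rw [hw]
  exact not_not.1 (mt (h α) hα)

theorem mem_feasibleSet_iff {g : MvPolynomial (Fin n) ℝ} :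
    g ∈ feasibleSet d w k ↔ g.IsHomogeneous d ∧ 1 - g ∈ truncatedModule w k := by
  rw [feasibleSet, Set.mem_ofPred_eq, ← and_assoc]
  refine and_congr_left fun _ => ⟨fun ⟨h1, h2⟩ => ?_, fun h => ⟨h.totalDegree_le, fun α hα =>
    h.coeff_eq_zero hα.ne⟩⟩
  refine isHomogeneous_of_coeff_eq_zero fun α hne => ?_
  rcases lt_or_gt_of_ne hne with hlt | hlt
  · exact h2 α hlt
  · exact coeff_eq_zero_of_totalDegree_lt (h1.trans_lt hlt)

theorem continuous_coeff_oneSub (α : Fin n →₀ ℕ) :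
    Continuous fun B : Params w k => coeff α (oneSub w k B) := by
  simp only [oneSub, sosOf, polyOf, coeff_sub, coeff_sum, Finset.sum_mul_sum]
  simp only [coeff_sum, Finset.sum_mul, monomial_mul, coeff_monomial_mul']
  refine continuous_const.sub (continuous_finsetSum _ fun j _ => continuous_finsetSum _ fun i _ =>
    continuous_finsetSum _ fun a _ => continuous_finsetSum _ fun b _ => ?_)
  split_ifs
  · fun_prop
  · exact continuous_const

theorem eval_oneSub (B : Params w k) (x : Fin n → ℝ) :
    eval x (oneSub w k B) = 1 - ∑ j, (∑ i, eval x (polyOf (B j i)) ^ 2) * eval x (weights w j) := by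
  simp [oneSub, eval_sosOf]

theorem continuous_eval_oneSub (x : Fin n → ℝ) :
    Continuous fun B : Params w k => eval x (oneSub w k B) := by
  simp only [eval_oneSub, eval_polyOf]
  fun_prop

/-- The parameters of the feasible nonnegative forms. -/
def feasibleParams (d : ℕ) (w : Fin s → MvPolynomial (Fin n) ℝ) (k : ℕ) : Set (Params w k) :=
  {B | (∀ j, weights w j = 0 → B j = 0) ∧
    (∀ α : Fin n →₀ ℕ, α.degree ≠ d → coeff α (oneSub w k B) = 0) ∧
    ∀ x : Fin n → ℝ, 0 ≤ eval x (oneSub w k B)}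

theorem exists_mem_feasibleParams_iff {g : MvPolynomial (Fin n) ℝ} :
    (∃ B ∈ feasibleParams d w k, oneSub w k B = g) ↔
      g ∈ feasibleSet d w k ∧ ∀ x : Fin n → ℝ, 0 ≤ eval x g := by
  rw [mem_feasibleSet_iff, one_sub_mem_truncatedModule_iff]
  constructor
  · rintro ⟨B, ⟨h1, h2, h3⟩, rfl⟩
    exact ⟨⟨isHomogeneous_of_coeff_eq_zero h2, B, h1, rfl⟩, h3⟩
  · rintro ⟨⟨hg, B, h1, rfl⟩, h3⟩
    exact ⟨B, ⟨h1, fun α hα => hg.coeff_eq_zero hα, h3⟩, rfl⟩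

theorem isClosed_feasibleParams : IsClosed (feasibleParams d w k) := by
  simp only [feasibleParams, Set.ofPred_and, Set.ofPred_forall]
  refine IsClosed.inter ?_ (IsClosed.inter ?_ ?_)
  · exact isClosed_iInter fun j => isClosed_iInter fun _ =>
      isClosed_eq (continuous_apply j) continuous_const
  · exact isClosed_iInter fun α => isClosed_iInter fun _ =>
      isClosed_eq (continuous_coeff_oneSub α) continuous_const
  · exact isClosed_iInter fun x => isClosed_le continuous_const (continuous_eval_oneSub x)

theorem exists_closedBall_weights_ge (hint : (interior (semialgebraicSet w)).Nonempty) :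
    ∃ (x₀ : Fin n → ℝ) (r δ : ℝ), 0 < r ∧ 0 < δ ∧
      Metric.closedBall x₀ r ⊆ semialgebraicSet w ∧
      ∀ x ∈ Metric.closedBall x₀ r, ∀ j, weights w j ≠ 0 → δ ≤ eval x (weights w j) := by
  classical
  obtain ⟨y, hy⟩ := hint
  obtain ⟨ε, hε, hball⟩ := Metric.nhds_basis_closedBall.mem_iff.1 (mem_interior_iff_mem_nhds.1 hy)
  -- Where the product of the nonzero weights does not vanish inside `K`, all of them are positive,
  -- and by continuity they stay so nearby.
  let W : MvPolynomial (Fin n) ℝ := ∏ j with weights w j ≠ 0, weights w j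
  have hW : W ≠ 0 := Finset.prod_ne_zero_iff.2 fun j hj => (Finset.mem_filter.1 hj).2
  obtain ⟨y₁, hy₁, hne⟩ : ∃ x ∈ Metric.closedBall y (ε / 2), eval x W ≠ 0 := by
    by_contra! h
    exact hW (eq_zero_of_eval_closedBall_eq_zero (half_pos hε) h)
  have hnhds : semialgebraicSet w ∈ 𝓝 y₁ :=
    mem_of_superset (Metric.closedBall_mem_nhds_of_mem
      (Metric.closedBall_subset_ball (half_lt_self hε) hy₁)) hball
  have hpos (j) (hj : weights w j ≠ 0) : 0 < eval y₁ (weights w j) := by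
    refine lt_of_le_of_ne ?_ ?_
    · cases j with
      | none => simp [weights]
      | some j => exact mem_of_mem_nhds hnhds j
    · rw [map_prod, Finset.prod_ne_zero_iff] at hne
      exact (hne j (by simpa using hj)).symm
  have hδ : ∀ᶠ δ in 𝓝[>] (0 : ℝ), ∀ j, weights w j ≠ 0 → δ < eval y₁ (weights w j) :=
    eventually_all.2 fun j => by
      by_cases hj : weights w j = 0
      · simp [hj]
      · filter_upwards [nhdsWithin_le_nhds (Iio_mem_nhds (hpos j hj))] with δ h _ using h
  obtain ⟨δ, hδ, hδ0⟩ := (hδ.and self_mem_nhdsWithin).exists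
  have hev : ∀ᶠ x in 𝓝 y₁, ∀ j, weights w j ≠ 0 → δ ≤ eval x (weights w j) :=
    eventually_all.2 fun j => by
      by_cases hj : weights w j = 0
      · simp [hj]
      · filter_upwards [(continuous_eval (weights w j)).continuousAt.eventually_const_lt (hδ j hj)]
          with x h _ using h.le
  obtain ⟨r, hr, h⟩ := Metric.nhds_basis_closedBall.mem_iff.1 (inter_mem hnhds hev)
  exact ⟨y₁, r, δ, hr, hδ0, fun x hx => (h hx).1, fun x hx => (h hx).2⟩

theorem isBounded_feasibleParams (hint : (interior (semialgebraicSet w)).Nonempty) :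
    Bornology.IsBounded (feasibleParams d w k) := by
  obtain ⟨x₀, r, δ, hr, hδ, hball, hge⟩ := exists_closedBall_weights_ge hint
  choose C hC using fun j => exists_norm_le_of_eval_closedBall_le k (halfDegree (weights w j)) x₀ hr
  -- Each single square satisfies `p ^ 2 * δ ≤ ∑ σ_j w_j ≤ 1` on the ball.
  let M := Real.sqrt (1 / δ)
  have hM : 0 ≤ M := Real.sqrt_nonneg _
  refine (isBounded_iff_forall_norm_le).2 ⟨∑ j, |C j| * M, fun B hB => ?_⟩
  have hsum : 0 ≤ ∑ j, |C j| * M := Finset.sum_nonneg fun j _ => by positivity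
  refine (pi_norm_le_iff_of_nonneg hsum).2 fun j => (pi_norm_le_iff_of_nonneg hsum).2 fun i => ?_
  have hle : ‖B j i‖ ≤ |C j| * M := by
    by_cases hj : weights w j = 0
    · rw [hB.1 j hj]
      simpa using by positivity
    refine (hC j (B j i) M hM fun x hx => ?_).trans
      (mul_le_mul_of_nonneg_right (le_abs_self _) hM)
    have hw (j) : 0 ≤ eval x (weights w j) := by
      cases j with
      | none => simp [weights]
      | some j => exact hball hx j
    have h1 := hB.2.2 x
    rw [eval_oneSub, sub_nonneg] at h1
    have h2 := (Finset.single_le_sum (f := fun j =>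
      (∑ i, eval x (polyOf (B j i)) ^ 2) * eval x (weights w j))
      (fun j _ => mul_nonneg (Finset.sum_nonneg fun i _ => sq_nonneg _) (hw j))
      (Finset.mem_univ j)).trans h1
    have h3 := Finset.single_le_sum (f := fun i => eval x (polyOf (B j i)) ^ 2)
      (fun i _ => sq_nonneg _) (Finset.mem_univ i)
    refine Real.abs_le_sqrt ?_
    rw [le_div_iff₀ hδ]
    exact (mul_le_mul h3 (hge x hx j hj) hδ.le ((sq_nonneg _).trans h3)).trans h2
  exact hle.trans (Finset.single_le_sum (f := fun j => |C j| * M) (fun j _ => by positivity)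
    (Finset.mem_univ j))

theorem isCompact_feasibleParams (hint : (interior (semialgebraicSet w)).Nonempty) :
    IsCompact (feasibleParams d w k) :=
  Metric.isCompact_of_isClosed_isBounded isClosed_feasibleParams (isBounded_feasibleParams hint)

/-! ### Semicontinuity, finiteness and strict convexity of the objective. -/

theorem continuous_ofReal_exp_neg_eval (g : MvPolynomial (Fin n) ℝ) :
    Continuous fun x : Fin n → ℝ => ENNReal.ofReal (Real.exp (-eval x g)) :=
  ENNReal.continuous_ofReal.comp (Real.continuous_exp.comp (continuous_eval g).neg)

theorem lowerSemicontinuous_objective_oneSub :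
    LowerSemicontinuous fun B : Params w k => objective (oneSub w k B) := by
  refine lowerSemicontinuous_iff_le_liminf.2 fun B => ?_
  refine le_trans (le_of_eq ?_) (lintegral_liminf_le fun B' =>
    (continuous_ofReal_exp_neg_eval (oneSub w k B')).measurable)
  refine lintegral_congr fun x => ?_
  have h : Continuous fun B : Params w k => ENNReal.ofReal (Real.exp (-eval x (oneSub w k B))) :=
    ENNReal.continuous_ofReal.comp (Real.continuous_exp.comp (continuous_eval_oneSub x).neg)
  exact (h.tendsto B).liminf_eq.symm

theorem eval_smul_of_isHomogeneous {g : MvPolynomial (Fin n) ℝ} (hg : g.IsHomogeneous d) (t : ℝ)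
    (x : Fin n → ℝ) : eval (t • x) g = t ^ d * eval x g := by
  rw [eval_eq, eval_eq, Finset.mul_sum]
  refine Finset.sum_congr rfl fun α hα => ?_
  simp only [Pi.smul_apply, smul_eq_mul, mul_pow, Finset.prod_mul_distrib,
    Finset.prod_pow_eq_pow_sum]
  rw [← hg.degree_eq_sum_deg_support hα]
  ring

/-- The negative set is an open cone: doubling maps it into itself but multiplies its positive
volume by `2 ^ n`. -/
theorem volume_eval_neg_eq_top {g : MvPolynomial (Fin n) ℝ} (hg : g.IsHomogeneous d) (hd : 0 < d)
    {x₀ : Fin n → ℝ} (hx₀ : eval x₀ g < 0) :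
    volume {x : Fin n → ℝ | eval x g < 0} = ∞ := by
  -- In dimension `0` the only point is the origin, where a form of positive degree vanishes.
  have hn : n ≠ 0 := by
    rintro rfl
    have h := eval_smul_of_isHomogeneous hg 2 x₀
    rw [Subsingleton.elim ((2 : ℝ) • x₀) x₀] at h
    nlinarith [one_lt_pow₀ (one_lt_two (α := ℝ)) hd.ne']
  have hopen : IsOpen {x : Fin n → ℝ | eval x g < 0} :=
    isOpen_lt (continuous_eval g) continuous_const
  have hpos : volume {x : Fin n → ℝ | eval x g < 0} ≠ 0 := hopen.measure_ne_zero _ ⟨x₀, hx₀⟩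
  have hsub : (2 : ℝ) • {x : Fin n → ℝ | eval x g < 0} ⊆ {x | eval x g < 0} := by
    rintro _ ⟨x, hx, rfl⟩
    change eval ((2 : ℝ) • x) g < 0
    rw [eval_smul_of_isHomogeneous hg]
    exact mul_neg_of_pos_of_neg (by positivity) hx
  have hle := measure_mono (μ := volume) hsub
  rw [Measure.addHaar_smul_of_nonneg _ zero_le_two, Module.finrank_fin_fun] at hle
  by_contra htop
  have h1 : (1 : ℝ≥0∞) < ENNReal.ofReal (2 ^ n) := by
    rw [ENNReal.one_lt_ofReal]
    exact one_lt_pow₀ one_lt_two hn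
  have h2 := ENNReal.mul_lt_mul_left hpos htop h1
  exact absurd hle (not_le.2 (by simpa [mul_comm] using h2))

theorem objective_eq_top_of_eval_neg {g : MvPolynomial (Fin n) ℝ} (hg : g.IsHomogeneous d)
    (hd : 0 < d) {x₀ : Fin n → ℝ} (hx₀ : eval x₀ g < 0) : objective g = ∞ := by
  rw [← top_le_iff, ← volume_eval_neg_eq_top hg hd hx₀]
  have h := mul_meas_ge_le_lintegral (μ := volume) (continuous_ofReal_exp_neg_eval g).measurable 1
  rw [one_mul] at h
  refine (measure_mono fun x hx => ?_).trans h
  change 1 ≤ ENNReal.ofReal _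
  rw [ENNReal.one_le_ofReal, Real.one_le_exp_iff]
  exact (neg_pos.2 hx).le

theorem mem_finiteVolumeForms_of_objective_lt_top {g : MvPolynomial (Fin n) ℝ}
    (hg : g.IsHomogeneous d) (hd : 0 < d) (hobj : objective g < ∞) :
    g ∈ finiteVolumeForms n d := by
  refine ⟨hg, fun x => ?_, ?_⟩
  · by_contra! hx
    exact hobj.ne (objective_eq_top_of_eval_neg hg hd hx)
  -- Markov's inequality: `exp (-g) ≥ exp (-1)` on the sublevel set.
  · have h := mul_meas_ge_le_lintegral (μ := volume) (continuous_ofReal_exp_neg_eval g).measurable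
      (ENNReal.ofReal (Real.exp (-1)))
    refine lt_of_le_of_lt (measure_mono fun x hx => ?_) (ENNReal.lt_top_of_mul_ne_top_right
      (h.trans_lt hobj).ne (by simp [Real.exp_pos]))
    exact ENNReal.ofReal_le_ofReal (Real.exp_le_exp.2 (neg_le_neg hx))

/-- Integrating `e^(-g) + e^(-h) = 2 e^(-(g+h)/2) + (e^(-g/2) - e^(-h/2))^2` shows that the last
square has integral zero; being continuous, it vanishes everywhere. -/
theorem eq_of_objective_le_midpoint {g h : MvPolynomial (Fin n) ℝ} (hfin : objective g < ∞)
    (heq : objective h = objective g) (hle : objective g ≤ objective (C (1 / 2) * (g + h))) :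
    g = h := by
  let D : (Fin n → ℝ) → ℝ := fun x => (Real.exp (-eval x g / 2) - Real.exp (-eval x h / 2)) ^ 2
  have hD : Continuous D := by
    have h1 := continuous_eval g
    have h2 := continuous_eval h
    fun_prop
  have hDm : Continuous fun x => ENNReal.ofReal (D x) := ENNReal.continuous_ofReal.comp hD
  have hsum : objective (C (1 / 2) * (g + h)) + objective (C (1 / 2) * (g + h)) +
      ∫⁻ x, ENNReal.ofReal (D x) = objective g + objective h := by
    have hp := (continuous_ofReal_exp_neg_eval (C (1 / 2) * (g + h))).measurable
    unfold objective
    rw [← lintegral_add_left hp, ← lintegral_add_left (hp.fun_add hp),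
      ← lintegral_add_left (continuous_ofReal_exp_neg_eval g).measurable]
    refine lintegral_congr fun x => ?_
    rw [← ENNReal.ofReal_add (Real.exp_nonneg _) (Real.exp_nonneg _),
      ← ENNReal.ofReal_add (by positivity) (sq_nonneg _),
      ← ENNReal.ofReal_add (Real.exp_nonneg _) (Real.exp_nonneg _)]
    congr 1
    have e1 : -eval x g = -eval x g / 2 + -eval x g / 2 := by ring
    have e2 : -eval x h = -eval x h / 2 + -eval x h / 2 := by ring
    have e3 : -eval x (C (1 / 2) * (g + h)) = -eval x g / 2 + -eval x h / 2 := by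
      simp only [map_mul, eval_C, map_add]
      ring
    rw [e3]
    conv_rhs => rw [e1, e2]
    simp only [Real.exp_add]
    ring
  have hzero : ∫⁻ x, ENNReal.ofReal (D x) = 0 := by
    have h1 : objective g + objective g + ∫⁻ x, ENNReal.ofReal (D x) ≤
        objective g + objective g + 0 := by
      rw [add_zero]
      calc _ ≤ _ := by gcongr
        _ = _ := hsum
        _ = _ := by rw [heq]
    exact le_zero_iff.1 ((ENNReal.add_le_add_iff_left (ENNReal.add_lt_top.2 ⟨hfin, hfin⟩).ne).1 h1)
  rw [lintegral_eq_zero_iff hDm.measurable, hDm.ae_eq_iff_eq volume continuous_zero] at hzero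
  refine MvPolynomial.funext fun x => ?_
  have hx : D x ≤ 0 := ENNReal.ofReal_eq_zero.1 (congrFun hzero x)
  have hx0 := pow_eq_zero_iff (two_ne_zero) |>.1 (le_antisymm hx (sq_nonneg _))
  have := Real.exp_injective (sub_eq_zero.1 hx0)
  linarith

/-! ### Convexity of the feasible set and a feasible form of finite objective. -/

theorem isSumSq_C {c : ℝ} (hc : 0 ≤ c) : IsSumSq (C c : MvPolynomial (Fin n) ℝ) := by
  rw [← Real.mul_self_sqrt hc, C_mul]
  exact IsSumSq.mul_self _

theorem truncatedSOS_mul {v e : ℕ} {τ σ : MvPolynomial (Fin n) ℝ} (hτ : IsSumSq τ)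
    (hdeg : τ.totalDegree ≤ 2 * e) (hσ : σ ∈ truncatedSOS n k v) :
    τ * σ ∈ truncatedSOS n (k + e) v := by
  refine ⟨hτ.mul hσ.1, ?_⟩
  rcases hσ.2 with rfl | h
  · simp
  · have := totalDegree_mul τ σ
    omega

theorem truncatedSOS_add {v : ℕ} {σ τ : MvPolynomial (Fin n) ℝ} (hσ : σ ∈ truncatedSOS n k v)
    (hτ : τ ∈ truncatedSOS n k v) : σ + τ ∈ truncatedSOS n k v := by
  refine ⟨hσ.1.add hτ.1, ?_⟩
  rcases hσ.2 with rfl | h1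
  · simpa using hτ.2
  rcases hτ.2 with rfl | h2
  · simpa using Or.inr h1
  · have := totalDegree_add σ τ
    omega

theorem truncatedModule_mul {e : ℕ} {τ p : MvPolynomial (Fin n) ℝ} (hτ : IsSumSq τ)
    (hdeg : τ.totalDegree ≤ 2 * e) (hp : p ∈ truncatedModule w k) :
    τ * p ∈ truncatedModule w (k + e) := by
  obtain ⟨σ₀, σ, h0, h, rfl⟩ := hp
  refine ⟨τ * σ₀, fun j => τ * σ j, truncatedSOS_mul hτ hdeg h0,
    fun j => truncatedSOS_mul hτ hdeg (h j), ?_⟩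
  simp [mul_add, Finset.mul_sum, mul_assoc]

theorem truncatedModule_add {p q : MvPolynomial (Fin n) ℝ} (hp : p ∈ truncatedModule w k)
    (hq : q ∈ truncatedModule w k) : p + q ∈ truncatedModule w k := by
  obtain ⟨σ₀, σ, h0, h, rfl⟩ := hp
  obtain ⟨τ₀, τ, h0', h', rfl⟩ := hq
  refine ⟨σ₀ + τ₀, fun j => σ j + τ j, truncatedSOS_add h0 h0',
    fun j => truncatedSOS_add (h j) (h' j), ?_⟩
  simp only [add_mul, Finset.sum_add_distrib]
  ring

theorem midpoint_mem_feasibleSet {g h : MvPolynomial (Fin n) ℝ} (hg : g ∈ feasibleSet d w k)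
    (hh : h ∈ feasibleSet d w k) : C (1 / 2) * (g + h) ∈ feasibleSet d w k := by
  rw [mem_feasibleSet_iff] at *
  refine ⟨(hg.1.add hh.1).C_mul _, ?_⟩
  have hmul := truncatedModule_mul (e := 0) (isSumSq_C (n := n) (c := 1 / 2) (by norm_num))
    (by simp) (truncatedModule_add hg.2 hh.2)
  have hC : (C (1 / 2) : MvPolynomial (Fin n) ℝ) * 2 = 1 := by
    rw [← map_ofNat (C : ℝ →+* MvPolynomial (Fin n) ℝ) 2, ← C_mul]
    norm_num
  have heq : 1 - C (1 / 2) * (g + h) = C (1 / 2) * (1 - g + (1 - h)) := by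
    linear_combination -hC
  rwa [heq]

theorem sumSq_pow_mem_feasibleSet {M : ℝ} (hM : 0 < M) {k₁ m : ℕ} (hm : 0 < m)
    (h : C M - ∑ i : Fin n, (X i : MvPolynomial (Fin n) ℝ) ^ 2 ∈ truncatedModule w k₁)
    (hk : k₁ + (m - 1) ≤ k) :
    C (M ^ m)⁻¹ * (∑ i : Fin n, (X i : MvPolynomial (Fin n) ℝ) ^ 2) ^ m ∈
      feasibleSet (2 * m) w k := by
  set q : MvPolynomial (Fin n) ℝ := ∑ i, X i ^ 2 with hqdef
  have hq : q.IsHomogeneous 2 := IsHomogeneous.sum _ _ _ fun i _ => isHomogeneous_X_pow i 2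
  rw [mem_feasibleSet_iff]
  refine ⟨(hq.pow m).C_mul _, ?_⟩
  have hsq : IsSumSq q := IsSumSq.sum_sq _ _
  have hpow (i : ℕ) : IsSumSq (q ^ i) := by
    induction i with
    | zero => simp
    | succ i ih => simpa [pow_succ] using ih.mul hsq
  -- Geometric sum: `1 - q^m / M^m = τ (M - q)`, with `τ` a sum of squares of degree at most `2 (m -
  -- 1)`.
  let τ : MvPolynomial (Fin n) ℝ :=
    C (M ^ m)⁻¹ * ∑ i ∈ Finset.range m, C M ^ i * q ^ (m - 1 - i)
  have hτ : IsSumSq τ := (isSumSq_C (by positivity)).mul (IsSumSq.sum fun i _ => by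
    rw [← C_pow]
    exact (isSumSq_C (by positivity)).mul (hpow _))
  have hdeg : τ.totalDegree ≤ 2 * (k - k₁) := by
    refine (totalDegree_mul _ _).trans ?_
    rw [totalDegree_C, zero_add]
    refine (totalDegree_finsetSum _ _).trans (Finset.sup_le fun i _ => ?_)
    refine (totalDegree_mul _ _).trans ?_
    rw [← C_pow, totalDegree_C, zero_add]
    have := (hq.pow (m - 1 - i)).totalDegree_le
    omega
  have hmem := truncatedModule_mul hτ hdeg h
  rw [Nat.add_sub_cancel' (by omega)] at hmem
  have hC : (C (M ^ m)⁻¹ : MvPolynomial (Fin n) ℝ) * C M ^ m = 1 := by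
    rw [← C_pow, ← C_mul, inv_mul_cancel₀ (by positivity), C_1]
  have heq : 1 - C (M ^ m)⁻¹ * q ^ m = τ * (C M - q) := by
    rw [mul_assoc, (Commute.all (C M) q).geom_sum₂_mul]
    linear_combination -hC
  rwa [heq]

theorem objective_sumSq_pow_lt_top {c : ℝ} (hc : 0 < c) {m : ℕ} (hm : 0 < m) :
    objective (C c * (∑ i : Fin n, (X i : MvPolynomial (Fin n) ℝ) ^ 2) ^ m) < ∞ := by
  have hint : Integrable (fun x : Fin n → ℝ => Real.exp c * ∏ i, Real.exp (-c * x i ^ 2)) :=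
    (Integrable.fintype_prod (f := fun _ y => Real.exp (-c * y ^ 2))
      fun _ => integrable_exp_neg_mul_sq hc).const_mul _
  refine lt_of_le_of_lt (lintegral_mono fun x => ENNReal.ofReal_le_ofReal ?_)
    hint.lintegral_lt_top
  rw [← Real.exp_sum, ← Real.exp_add, Real.exp_le_exp, ← Finset.mul_sum]
  simp only [map_mul, eval_C, map_pow, map_sum, eval_X]
  have hq : 0 ≤ ∑ i, x i ^ 2 := Finset.sum_nonneg fun i _ => sq_nonneg _
  -- This dominates the integrand by `exp c` times a Gaussian.
  have hpow : ∑ i, x i ^ 2 ≤ 1 + (∑ i, x i ^ 2) ^ m := by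
    rcases le_total (∑ i, x i ^ 2) 1 with h | h
    · linarith [pow_nonneg hq m]
    · linarith [le_self_pow₀ h hm.ne']
  nlinarith

end LownerJohn
end

/-! ### Existence and uniqueness of the minimizer. -/

theorem theorem5p2 (n s d : ℕ) (hd : Even d) (hd0 : 0 < d)
    (w : Fin s → MvPolynomial (Fin n) ℝ)
    (hcompact : IsCompact (LownerJohn.semialgebraicSet w))
    (hinterior : (interior (LownerJohn.semialgebraicSet w)).Nonempty)
    (harch : LownerJohn.Archimedean w) :
    ∃ k₀ : ℕ, ∀ k : ℕ, k₀ ≤ k →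
      ∃ g ∈ LownerJohn.finiteVolumeForms n d,
        LownerJohn.IsOptimalSolution d w k g ∧
        ∀ h : MvPolynomial (Fin n) ℝ, LownerJohn.IsOptimalSolution d w k h → h = g := by
  open LownerJohn MvPolynomial in
  obtain ⟨M, hM, k₁, hk₁⟩ := harch
  obtain ⟨m, rfl⟩ := hd.exists_two_nsmul
  rw [smul_eq_mul] at *
  have hm : 0 < m := by omega
  refine ⟨k₁ + (m - 1), fun k hk => ?_⟩
  have hf := sumSq_pow_mem_feasibleSet hM hm hk₁ hk
  have hfin := objective_sumSq_pow_lt_top (n := n) (c := (M ^ m)⁻¹) (by positivity) hm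
  obtain ⟨B₀, hB₀, hB₀eq⟩ := exists_mem_feasibleParams_iff.2 ⟨hf,
    (mem_finiteVolumeForms_of_objective_lt_top (mem_feasibleSet_iff.1 hf).1 hd0 hfin).2.1⟩
  obtain ⟨B, hB, hmin⟩ := LowerSemicontinuousOn.exists_isMinOn ⟨B₀, hB₀⟩
    (isCompact_feasibleParams hinterior)
    (lowerSemicontinuous_objective_oneSub.lowerSemicontinuousOn _)
  have hgf := (exists_mem_feasibleParams_iff.1 ⟨B, hB, rfl⟩).1
  have hgfin : objective (oneSub w k B) < ⊤ := by
    refine lt_of_le_of_lt (hmin hB₀) ?_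
    simpa only [hB₀eq] using hfin
  have hopt : IsOptimalSolution (2 * m) w k (oneSub w k B) := by
    refine ⟨hgf, fun h hh => ?_⟩
    by_cases hpos : ∀ x : Fin n → ℝ, 0 ≤ MvPolynomial.eval x h
    · obtain ⟨B', hB', rfl⟩ := exists_mem_feasibleParams_iff.2 ⟨hh, hpos⟩
      exact hmin hB'
    · push Not at hpos
      obtain ⟨x, hx⟩ := hpos
      rw [objective_eq_top_of_eval_neg (mem_feasibleSet_iff.1 hh).1 hd0 hx]
      exact le_top
  refine ⟨_, mem_finiteVolumeForms_of_objective_lt_top (mem_feasibleSet_iff.1 hgf).1 hd0 hgfin,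
    hopt, fun h hh => (eq_of_objective_le_midpoint hgfin ?_ ?_).symm⟩
  · exact le_antisymm (hh.2 _ hgf) (hopt.2 _ hh.1)
  · exact hopt.2 _ (midpoint_mem_feasibleSet hgf hh.1)
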